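/- Let $\Phi$ be a point process on $\mathbb{R}^d$ ($d\ge 1$), i.e. a random locally finite counting measure (multiple points are allowed), whose mean measure $\alpha(B)=\mathbf{E}\,\Phi(B)$ is locally finite. Definitions. $\Phi$ is *associated* if $\mathrm{Cov}\big(f(\Phi(B_1),\dots,\Phi(B_k)),\,g(\Phi(B_1),\dots,\Phi(B_k))\big)\ge 0$ for all bounded Borel sets $B_1,\dots,B_k$ and all componentwise increasing $f,g:\mathbb{R}^k\to[0,1]$. It is *negatively associated* if $\mathrm{Cov}\big(f(\Phi(B_1),\dots,\Phi(B_k)),\,g(\Phi(B_{k+1}),\dots,\Phi(B_l))\big)\le 0$ for all bounded Borel sets $B_1,\dots,B_l$ with $(B_1\cup\dots\cup B_k)\cap(B_{k+1}\cup\dots\cup B_l)=\emptyset$ and all componentwise increasing $f,g$ with values in $[0,1]$. A Borel function $f:\mathbb{R}^k\to\mathbb{R}$ is *directionally convex* (dcx) if $\Delta^i_\varepsilon\Delta^j_\delta f(x)\ge 0$ for all $x\in\mathbb{R}^k$, $\varepsilon,\delta>0$ and $i,j\in\{1,\dots,k\}$, where $\Delta^i_\varepsilon f(x)=f(x+\varepsilon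 e_i)-f(x)$. For random vectors, $X\le_{\mathrm{dcx}}Y$ means that $\mathbf{E}f(X)\le\mathbf{E}f(Y)$ for all dcx $f$ for which both expectations are finite. For real random variables, $X\le_{\mathrm{cx}}Y$ means the same with all convex $f:\mathbb{R}\to\mathbb{R}$. For point processes, $\Phi_1\le_{\mathrm{dcx}}\Phi_2$ means that $(\Phi_1(B_1),\dots,\Phi_1(B_k))\le_{\mathrm{dcx}}(\Phi_2(B_1),\dots,\Phi_2(B_k))$ for all $k$ and all bounded Borel sets $B_1,\dots,B_k$. The Poisson point process $\Pi_\alpha$ with intensity measure $\alpha$ is the point process for which, for all bounded, mutually disjoint Borel sets $B_1,\dots,B_k$, the variables $\Pi_\alpha(B_1),\dots,\Pi_\alpha(B_k)$ are independent with distributions $\mathrm{Pois}(\alpha(B_1)),\dots,\mathrm{Pois}(\alpha(B_k))$. **Proposition.** 1. If $\Phi$ is negatively associated and $\Phi(B)\le_{\mathrm{cx}}\mathrm{Pois}(\mathbf{E}\,\Phi(B))$ for all bounded Borel sets $B$, then $\Phi$ is dcx sub-Poisson, i.e. $\Phi\le_{\mathrm{dcx}}\Pi_\alpha$. 2. If $\Phi$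 is associated and $\mathrm{Pois}(\mathbf{E}\,\Phi(B))\le_{\mathrm{cx}}\Phi(B)$ for all bounded Borel sets $B$, then $\Phi$ is dcx super-Poisson, i.e. $\Pi_\alpha\le_{\mathrm{dcx}}\Phi$. -/

import Mathlib

open MeasureTheory ProbabilityTheory

universe u v

noncomputable section

/-- A point process on `ℝ^d`, defined on the probability space `(Ω, P)`: a random measure which,
almost surely, takes values in `{0, 1, 2, …}` on all bounded Borel sets. -/
structure IsPointProcess {d : ℕ} {Ω : Type u} [MeasurableSpace Ω]
    (Φ : Ω → Measure (EuclideanSpace ℝ (Fin d))) (P : Measure Ω) : Prop where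
  measurable : Measurable Φ
  counting : ∀ᵐ ω ∂P, ∀ B : Set (EuclideanSpace ℝ (Fin d)),
    MeasurableSet B → Bornology.IsBounded B → ∃ n : ℕ, Φ ω B = n

/-- The (random) number of points in `B`, as a real random variable. -/
def pointCount {d : ℕ} {Ω : Type u} (Φ : Ω → Measure (EuclideanSpace ℝ (Fin d)))
    (B : Set (EuclideanSpace ℝ (Fin d))) (ω : Ω) : ℝ :=
  (Φ ω).real B

/-- The random vector `(Φ(B₁), …, Φ(B_k))`. -/
def countVector {d : ℕ} {Ω : Type u} (Φ : Ω → Measure (EuclideanSpace ℝ (Fin d)))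
    {k : ℕ} (B : Fin k → Set (EuclideanSpace ℝ (Fin d))) (ω : Ω) : Fin k → ℝ :=
  fun i => pointCount Φ (B i) ω

/-- The mean (intensity) measure `B ↦ E Φ(B)`. -/
def meanMeasure {d : ℕ} {Ω : Type u} [MeasurableSpace Ω]
    (Φ : Ω → Measure (EuclideanSpace ℝ (Fin d))) (P : Measure Ω) :
    Measure (EuclideanSpace ℝ (Fin d)) :=
  P.bind Φ

theorem meanMeasure_apply {d : ℕ} {Ω : Type u} [MeasurableSpace Ω]
    {Φ : Ω → Measure (EuclideanSpace ℝ (Fin d))} {P : Measure Ω} (hΦ : IsPointProcess Φ P)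
    {B : Set (EuclideanSpace ℝ (Fin d))} (hB : MeasurableSet B) :
    meanMeasure Φ P B = ∫⁻ ω, Φ ω B ∂P :=
  Measure.bind_apply hB hΦ.measurable.aemeasurable

/-- `Ψ` is a Poisson point process with (locally finite) intensity measure `Λ`. -/
structure IsPoissonPointProcess {d : ℕ} {Ω : Type u} [MeasurableSpace Ω]
    (Ψ : Ω → Measure (EuclideanSpace ℝ (Fin d))) (P : Measure Ω)
    (Λ : Measure (EuclideanSpace ℝ (Fin d))) : Prop where
  isPointProcess : IsPointProcess Ψ P
  locallyFinite : IsLocallyFiniteMeasure Λ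
  indep : ∀ (k : ℕ) (B : Fin k → Set (EuclideanSpace ℝ (Fin d))),
    (∀ i, MeasurableSet (B i)) → (∀ i, Bornology.IsBounded (B i)) →
    Pairwise (fun i j => Disjoint (B i) (B j)) →
    iIndepFun (fun i => pointCount Ψ (B i)) P
  law : ∀ B : Set (EuclideanSpace ℝ (Fin d)), MeasurableSet B → Bornology.IsBounded B →
    P.map (pointCount Ψ B) = (poissonMeasure (Λ B).toNNReal).map (Nat.cast : ℕ → ℝ)

/-- (Positive) association of a point process. -/
def IsAssociated {d : ℕ} {Ω : Type u} [MeasurableSpace Ω]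
    (Φ : Ω → Measure (EuclideanSpace ℝ (Fin d))) (P : Measure Ω) : Prop :=
  ∀ (k : ℕ) (B : Fin k → Set (EuclideanSpace ℝ (Fin d))),
    (∀ i, MeasurableSet (B i)) → (∀ i, Bornology.IsBounded (B i)) →
    ∀ f g : (Fin k → ℝ) → ℝ, Monotone f → Monotone g →
      (∀ x, f x ∈ Set.Icc (0 : ℝ) 1) → (∀ x, g x ∈ Set.Icc (0 : ℝ) 1) →
      0 ≤ covariance (fun ω => f (countVector Φ B ω)) (fun ω => g (countVector Φ B ω)) P

/-- Negative association of a point process. -/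
def IsNegativelyAssociated {d : ℕ} {Ω : Type u} [MeasurableSpace Ω]
    (Φ : Ω → Measure (EuclideanSpace ℝ (Fin d))) (P : Measure Ω) : Prop :=
  ∀ (k m : ℕ) (B : Fin k → Set (EuclideanSpace ℝ (Fin d)))
    (C : Fin m → Set (EuclideanSpace ℝ (Fin d))),
    (∀ i, MeasurableSet (B i)) → (∀ i, Bornology.IsBounded (B i)) →
    (∀ j, MeasurableSet (C j)) → (∀ j, Bornology.IsBounded (C j)) →
    Disjoint (⋃ i, B i) (⋃ j, C j) →
    ∀ (f : (Fin k → ℝ) → ℝ) (g : (Fin m → ℝ) → ℝ), Monotone f → Monotone g →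
      (∀ x, f x ∈ Set.Icc (0 : ℝ) 1) → (∀ x, g x ∈ Set.Icc (0 : ℝ) 1) →
      covariance (fun ω => f (countVector Φ B ω)) (fun ω => g (countVector Φ C ω)) P ≤ 0

/-- The discrete difference operator `Δ_ε^i f (x) = f (x + ε e_i) - f x`. -/
def diffOp {k : ℕ} (i : Fin k) (ε : ℝ) (f : (Fin k → ℝ) → ℝ) (x : Fin k → ℝ) : ℝ :=
  f (x + Pi.single i ε) - f x

/-- Directionally convex functions on `ℝ^k`. -/
structure DirectionallyConvex {k : ℕ} (f : (Fin k → ℝ) → ℝ) : Prop where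
  measurable : Measurable f
  diff_nonneg : ∀ (x : Fin k → ℝ) (ε δ : ℝ), 0 < ε → 0 < δ → ∀ i j : Fin k,
    0 ≤ diffOp i ε (diffOp j δ f) x

/-- The dcx order of random vectors `X` on `(Ω, P)` and `Y` on `(Ω', P')`. -/
def DcxLE {k : ℕ} {Ω : Type u} {Ω' : Type v} [MeasurableSpace Ω] [MeasurableSpace Ω']
    (X : Ω → Fin k → ℝ) (P : Measure Ω) (Y : Ω' → Fin k → ℝ) (P' : Measure Ω') : Prop :=
  ∀ f : (Fin k → ℝ) → ℝ, DirectionallyConvex f →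
    Integrable (fun ω => f (X ω)) P → Integrable (fun ω => f (Y ω)) P' →
    ∫ ω, f (X ω) ∂P ≤ ∫ ω, f (Y ω) ∂P'

/-- The convex order of real random variables `X` on `(Ω, P)` and `Y` on `(Ω', P')`. -/
def CxLE {Ω : Type u} {Ω' : Type v} [MeasurableSpace Ω] [MeasurableSpace Ω']
    (X : Ω → ℝ) (P : Measure Ω) (Y : Ω' → ℝ) (P' : Measure Ω') : Prop :=
  ∀ φ : ℝ → ℝ, ConvexOn ℝ Set.univ φ →
    Integrable (fun ω => φ (X ω)) P → Integrable (fun ω => φ (Y ω)) P' →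
    ∫ ω, φ (X ω) ∂P ≤ ∫ ω, φ (Y ω) ∂P'

/-- The dcx order of point processes. -/
def PointProcessDcxLE {d : ℕ} {Ω : Type u} {Ω' : Type v} [MeasurableSpace Ω] [MeasurableSpace Ω']
    (Φ : Ω → Measure (EuclideanSpace ℝ (Fin d))) (P : Measure Ω)
    (Ψ : Ω' → Measure (EuclideanSpace ℝ (Fin d))) (P' : Measure Ω') : Prop :=
  ∀ (k : ℕ) (B : Fin k → Set (EuclideanSpace ℝ (Fin d))),
    (∀ i, MeasurableSet (B i)) → (∀ i, Bornology.IsBounded (B i)) →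
    DcxLE (countVector Φ B) P (countVector Ψ B) P'

/-- `Φ(B) ≤_cx Pois(E Φ(B))` for all bounded Borel sets `B`. -/
def HasConvexlySubPoissonMarginals {d : ℕ} {Ω : Type u} [MeasurableSpace Ω]
    (Φ : Ω → Measure (EuclideanSpace ℝ (Fin d))) (P : Measure Ω) : Prop :=
  ∀ B : Set (EuclideanSpace ℝ (Fin d)), MeasurableSet B → Bornology.IsBounded B →
    CxLE (pointCount Φ B) P (fun n : ℕ => (n : ℝ)) (poissonMeasure (meanMeasure Φ P B).toNNReal)

/-- `Pois(E Φ(B)) ≤_cx Φ(B)` for all bounded Borel sets `B`. -/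
def HasConvexlySuperPoissonMarginals {d : ℕ} {Ω : Type u} [MeasurableSpace Ω]
    (Φ : Ω → Measure (EuclideanSpace ℝ (Fin d))) (P : Measure Ω) : Prop :=
  ∀ B : Set (EuclideanSpace ℝ (Fin d)), MeasurableSet B → Bornology.IsBounded B →
    CxLE (fun n : ℕ => (n : ℝ)) (poissonMeasure (meanMeasure Φ P B).toNNReal) (pointCount Φ B) P

/-- `Φ` is dcx smaller than the Poisson point process of the same mean measure, on whatever
probability space that process (which is determined in law) is realised. -/
def IsDcxSubPoisson {d : ℕ} {Ω : Type u} [MeasurableSpace Ω]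
    (Φ : Ω → Measure (EuclideanSpace ℝ (Fin d))) (P : Measure Ω) : Prop :=
  ∀ (Ω' : Type v) [MeasurableSpace Ω'] (P' : Measure Ω') [IsProbabilityMeasure P']
    (Ψ : Ω' → Measure (EuclideanSpace ℝ (Fin d))),
    IsPoissonPointProcess Ψ P' (meanMeasure Φ P) → PointProcessDcxLE Φ P Ψ P'

/-- `Φ` is dcx larger than the Poisson point process of the same mean measure, on whatever
probability space that process (which is determined in law) is realised. -/
def IsDcxSuperPoisson {d : ℕ} {Ω : Type u} [MeasurableSpace Ω]
    (Φ : Ω → Measure (EuclideanSpace ℝ (Fin d))) (P : Measure Ω) : Prop :=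
  ∀ (Ω' : Type v) [MeasurableSpace Ω'] (P' : Measure Ω') [IsProbabilityMeasure P']
    (Ψ : Ω' → Measure (EuclideanSpace ℝ (Fin d))),
    IsPoissonPointProcess Ψ P' (meanMeasure Φ P) → PointProcessDcxLE Ψ P' Φ P

end

open scoped ENNReal NNReal

/-! ### Monotonicity in each coordinate -/

/-! Cut the sets `B i` into disjoint cells. The counts of the `B i` are sums of cell counts, so a
dcx function of them becomes a function `h` on `ℕ^m` whose unit increments are increasing in every
coordinate. Subtracting from `h` its value and its slopes at the origin leaves a nonnegative
increasing `g` with the same property (`increasingDcx_sub_linear`). The subtracted part is affine,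
so it has the same expectation under both processes, whose means agree. It remains to compare `E g`,
and since `g ≥ 0` this can be done in `[0, ∞]` without integrability conditions.

The comparison is by induction on the number of cells. Let `X` be the first count and `Z` the
others. Telescoping gives `E g(X, Z) = E g(0, Z) + ∑ₜ E[1{X ≥ t+1} Dₜ(Z)]`, where `Dₜ(z) = g(t+1, z)
- g(t, z)` is nonnegative and increasing. Negative association bounds each term by `P(X ≥ t+1) E
Dₜ(Z)`, and the resulting sum is the expectation with `X` replaced by a copy independent of `Z`. For
fixed `z`, `n ↦ g(n, z)` is convex and increasing, so the convex order replaces that copy by a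
Poisson variable. For each fixed value of that variable, the induction hypothesis treats `Z`.
Association and the opposite convex order reverse every inequality. -/

theorem monotone_of_le_update {ι α : Type*} [Fintype ι] [DecidableEq ι] [Preorder α]
    {G : (ι → α) → ℝ} (hG : ∀ x i a, x i ≤ a → G x ≤ G (Function.update x i a)) :
    Monotone G := by
  intro x y hxy
  -- The coordinates in `s` have already been raised from `x` to `y`.
  have key : ∀ s : Finset ι, G x ≤ G (s.piecewise y x) := by
    intro s
    induction s using Finset.induction_on with
    | empty => simp
    | insert i s hi ih =>
      rw [Finset.piecewise_insert]
      exact ih.trans (hG _ _ _ (by simpa [hi] using hxy i))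
  simpa using key Finset.univ

theorem monotone_of_le_add_single_one {m : ℕ} {G : (Fin m → ℕ) → ℝ}
    (hG : ∀ x i, G x ≤ G (x + Pi.single i 1)) : Monotone G := by
  refine monotone_of_le_update fun x i a hxa => ?_
  obtain ⟨n, rfl⟩ := Nat.exists_eq_add_of_le hxa
  induction n with
  | zero => simp
  | succ n ih =>
    refine (ih (by omega)).trans ((hG _ i).trans_eq (congrArg G ?_))
    ext j
    by_cases h : j = i
    · subst h; simp [add_assoc]
    · simp [h]

theorem monotone_of_le_add_single {k : ℕ} {G : (Fin k → ℝ) → ℝ}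
    (hG : ∀ x i ε, 0 < ε → G x ≤ G (x + Pi.single i ε)) : Monotone G := by
  refine monotone_of_le_update fun x i a hxa => ?_
  rcases hxa.eq_or_lt with h | h
  · simp [← h]
  · refine (hG x i (a - x i) (sub_pos.2 h)).trans_eq (congrArg G ?_)
    ext j
    by_cases h : j = i
    · subst h; simp
    · simp [h]

/-! ### Directionally convex functions -/

theorem DirectionallyConvex.monotone_sub {k : ℕ} {f : (Fin k → ℝ) → ℝ}
    (hf : DirectionallyConvex f) {v : Fin k → ℝ} (hv : 0 ≤ v) :
    Monotone fun x => f (x + v) - f x := by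
  have h1 : ∀ (i : Fin k) (ε : ℝ), 0 < ε → Monotone fun x => f (x + Pi.single i ε) - f x := by
    intro i ε hε
    refine monotone_of_le_add_single fun x j δ hδ => ?_
    have := hf.diff_nonneg x δ ε hδ hε j i
    simp only [diffOp] at this
    linarith
  refine monotone_of_le_add_single fun x i ε hε => ?_
  -- A mixed difference is symmetric in its two steps: comparing the `v`-increment at `x` and at `x
  -- + ε e_i` amounts to comparing the `ε e_i`-increment at `x` and at `x + v`.
  have := h1 i ε hε (le_add_of_nonneg_right hv : x ≤ x + v)
  simp only [add_right_comm x (Pi.single i ε) v] at this ⊢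
  linarith

/-- Nonnegative increasing directionally convex functions on `ℕ^m`. -/
structure IncreasingDcx {m : ℕ} (g : (Fin m → ℕ) → ℝ) : Prop where
  nonneg : ∀ x, 0 ≤ g x
  mono : Monotone g
  mono_sub : ∀ i, Monotone fun x => g (x + Pi.single i 1) - g x

/-- The increments of `h` are smallest at the origin, the least point of `ℕ^m`. Removing those
slopes makes every increment nonnegative, and the result vanishes at `0`. Second differences do not
see the affine part. -/
theorem increasingDcx_sub_linear {m : ℕ} {h : (Fin m → ℕ) → ℝ}
    (hh : ∀ i, Monotone fun x => h (x + Pi.single i 1) - h x) :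
    IncreasingDcx fun x => h x - h 0 - ∑ i, (x i : ℝ) * (h (Pi.single i 1) - h 0) := by
  have hs : ∀ (x : Fin m → ℕ) (i : Fin m),
      ∑ j, (((x + Pi.single i 1 : Fin m → ℕ) j : ℕ) : ℝ) * (h (Pi.single j 1) - h 0) =
        ∑ j, (x j : ℝ) * (h (Pi.single j 1) - h 0) + (h (Pi.single i 1) - h 0) := by
    intro x i
    simp only [Pi.add_apply, Nat.cast_add, add_mul, Finset.sum_add_distrib]
    congr 1
    rw [Finset.sum_eq_single i] <;> simp +contextual
  have hm : Monotone fun x => h x - h 0 - ∑ i, (x i : ℝ) * (h (Pi.single i 1) - h 0) := by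
    refine monotone_of_le_add_single_one fun x i => ?_
    have := hh i (zero_le : 0 ≤ x)
    simp only [zero_add] at this
    simp only [hs]
    linarith
  refine ⟨fun x => ?_, hm, fun i x y hxy => ?_⟩
  · have := hm (zero_le : 0 ≤ x)
    simpa using this
  · have := hh i hxy
    simp only [hs] at this ⊢
    linarith

theorem cons_succ_eq_add_single {m : ℕ} (t : ℕ) (z : Fin m → ℕ) :
    (Fin.cons (t + 1) z : Fin (m + 1) → ℕ) = Fin.cons t z + Pi.single 0 1 := by
  ext i
  refine Fin.cases ?_ (fun j => ?_) i <;> simp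

theorem cons_add_single {m : ℕ} (t : ℕ) (z : Fin m → ℕ) (i : Fin m) :
    (Fin.cons t (z + Pi.single i 1) : Fin (m + 1) → ℕ) = Fin.cons t z + Pi.single i.succ 1 := by
  ext j
  refine Fin.cases ?_ (fun j => ?_) j
  · simp [Fin.succ_ne_zero, eq_comm]
  · simp [Pi.single_apply]

theorem cons_mono {m : ℕ} {s t : ℕ} {y z : Fin m → ℕ} (hst : s ≤ t) (hyz : y ≤ z) :
    (Fin.cons s y : Fin (m + 1) → ℕ) ≤ Fin.cons t z := by
  intro i
  refine Fin.cases ?_ (fun j => ?_) i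
  · simpa using hst
  · simpa using hyz j

theorem IncreasingDcx.cons {m : ℕ} {g : (Fin (m + 1) → ℕ) → ℝ} (hg : IncreasingDcx g) (t : ℕ) :
    IncreasingDcx fun z : Fin m → ℕ => g (Fin.cons t z) where
  nonneg _ := hg.nonneg _
  mono _ _ h := hg.mono (cons_mono le_rfl h)
  mono_sub i y z h := by
    simpa only [cons_add_single] using hg.mono_sub i.succ (cons_mono (le_refl t) h)

/-- Used twice: with `y = z` it is convexity in the first coordinate, and with `s = t` it says that
the first increment is an increasing function of the others. -/
theorem IncreasingDcx.mono_cons_sub {m : ℕ} {g : (Fin (m + 1) → ℕ) → ℝ} (hg : IncreasingDcx g)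
    {s t : ℕ} {y z : Fin m → ℕ} (hst : s ≤ t) (hyz : y ≤ z) :
    g (Fin.cons (s + 1) y) - g (Fin.cons s y) ≤ g (Fin.cons (t + 1) z) - g (Fin.cons t z) := by
  simpa only [cons_succ_eq_add_single] using hg.mono_sub 0 (cons_mono hst hyz)

/-! ### Expansions of functions on `ℕ` -/

theorem ofReal_eq_add_tsum {φ : ℕ → ℝ} (h0 : ∀ n, 0 ≤ φ n) (hm : Monotone φ) (n : ℕ) :
    ENNReal.ofReal (φ n) = ENNReal.ofReal (φ 0) +
      ∑' t, {x : ℕ | t + 1 ≤ x}.indicator (fun _ => ENNReal.ofReal (φ (t + 1) - φ t)) n := by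
  have hd : ∀ t, 0 ≤ φ (t + 1) - φ t := fun t => sub_nonneg.2 (hm t.le_succ)
  rw [tsum_eq_sum (s := Finset.range n)]
  · rw [Finset.sum_congr rfl (g := fun t => ENNReal.ofReal (φ (t + 1) - φ t)),
      ← ENNReal.ofReal_sum_of_nonneg (fun t _ => hd t), ← ENNReal.ofReal_add (h0 0),
      Finset.sum_range_sub]
    · simp
    · exact Finset.sum_nonneg fun t _ => hd t
    · intro t ht
      simp only [Finset.mem_range] at ht
      simp [Set.indicator, ht]
  · intro t ht
    simp only [Finset.mem_range] at ht
    simp [Set.indicator, ht]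

/-- Discrete Taylor formula of order two: second differences weighted by `(n - (t + 1))₊`. -/
theorem eq_add_sum_range_sub_mul (φ : ℕ → ℝ) (n : ℕ) :
    φ n = φ 0 + n * (φ 1 - φ 0) + ∑ t ∈ Finset.range n,
      ((n - (t + 1) : ℕ) : ℝ) * ((φ (t + 2) - φ (t + 1)) - (φ (t + 1) - φ t)) := by
  have hd : ∀ n, φ (n + 1) - φ n = φ 1 - φ 0 + ∑ t ∈ Finset.range n,
      ((φ (t + 2) - φ (t + 1)) - (φ (t + 1) - φ t)) := by
    intro n
    rw [Finset.sum_range_sub (fun t => φ (t + 1) - φ t)]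
    simp
  induction n with
  | zero => simp
  | succ n ih =>
    rw [Finset.sum_range_succ]
    have : ∑ t ∈ Finset.range n, ((n + 1 - (t + 1) : ℕ) : ℝ) *
        ((φ (t + 2) - φ (t + 1)) - (φ (t + 1) - φ t)) =
        ∑ t ∈ Finset.range n, ((n - (t + 1) : ℕ) : ℝ) *
          ((φ (t + 2) - φ (t + 1)) - (φ (t + 1) - φ t)) +
        ∑ t ∈ Finset.range n, ((φ (t + 2) - φ (t + 1)) - (φ (t + 1) - φ t)) := by
      rw [← Finset.sum_add_distrib]
      refine Finset.sum_congr rfl fun t ht => ?_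
      have ht := Finset.mem_range.1 ht
      rw [show n + 1 - (t + 1) = n - (t + 1) + 1 by omega]
      push_cast
      ring
    rw [this]
    have := hd n
    push_cast
    simp only [Nat.sub_self, Nat.cast_zero, zero_mul, add_zero]
    linarith

theorem ofReal_eq_add_tsum_sub_mul {φ : ℕ → ℝ} (h0 : ∀ n, 0 ≤ φ n) (hm : Monotone φ)
    (hc : Monotone fun n => φ (n + 1) - φ n) (n : ℕ) :
    ENNReal.ofReal (φ n) = ENNReal.ofReal (φ 0) + (n : ℝ≥0∞) * ENNReal.ofReal (φ 1 - φ 0) +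
      ∑' t, ((n - (t + 1) : ℕ) : ℝ≥0∞) *
        ENNReal.ofReal ((φ (t + 2) - φ (t + 1)) - (φ (t + 1) - φ t)) := by
  have hd : ∀ t, 0 ≤ (φ (t + 2) - φ (t + 1)) - (φ (t + 1) - φ t) :=
    fun t => sub_nonneg.2 (hc t.le_succ)
  have h1 : 0 ≤ φ 1 - φ 0 := sub_nonneg.2 (hm zero_le_one)
  rw [tsum_eq_sum (s := Finset.range n)]
  · rw [eq_add_sum_range_sub_mul φ n, ENNReal.ofReal_add (by have := h0 0; positivity),
      ENNReal.ofReal_add (h0 0) (by positivity), ENNReal.ofReal_mul (by positivity),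
      ENNReal.ofReal_natCast, ENNReal.ofReal_sum_of_nonneg]
    · congr 1
      refine Finset.sum_congr rfl fun t _ => ?_
      rw [ENNReal.ofReal_mul (by positivity), ENNReal.ofReal_natCast]
    · exact fun t _ => mul_nonneg (Nat.cast_nonneg _) (hd t)
    · exact Finset.sum_nonneg fun t _ => mul_nonneg (Nat.cast_nonneg _) (hd t)
  -- Truncated subtraction kills the terms with `t ≥ n`, so the coefficients of the series do not
  -- depend on `n`.
  · intro t ht
    simp only [Finset.mem_range] at ht
    simp [show n - (t + 1) = 0 by omega]

/-- An increasing convex function is a nonnegative combination of a constant and the functions `(n -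
t)₊`; the slope at `0` goes with `t = 0`, that is, with the means. -/
theorem lintegral_ofReal_mono_of_convex {μ ν : Measure ℕ} [IsProbabilityMeasure μ]
    [IsProbabilityMeasure ν]
    (h : ∀ t : ℕ, ∫⁻ n, ((n - t : ℕ) : ℝ≥0∞) ∂μ ≤ ∫⁻ n, ((n - t : ℕ) : ℝ≥0∞) ∂ν)
    {φ : ℕ → ℝ} (h0 : ∀ n, 0 ≤ φ n) (hm : Monotone φ) (hc : Monotone fun n => φ (n + 1) - φ n) :
    ∫⁻ n, ENNReal.ofReal (φ n) ∂μ ≤ ∫⁻ n, ENNReal.ofReal (φ n) ∂ν := by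
  have key : ∀ (ρ : Measure ℕ) [IsProbabilityMeasure ρ], ∫⁻ n, ENNReal.ofReal (φ n) ∂ρ =
      ENNReal.ofReal (φ 0) + (∫⁻ n, ((n - 0 : ℕ) : ℝ≥0∞) ∂ρ) * ENNReal.ofReal (φ 1 - φ 0) +
      ∑' t, (∫⁻ n, ((n - (t + 1) : ℕ) : ℝ≥0∞) ∂ρ) *
        ENNReal.ofReal ((φ (t + 2) - φ (t + 1)) - (φ (t + 1) - φ t)) := by
    intro ρ _
    rw [lintegral_congr fun n => ofReal_eq_add_tsum_sub_mul h0 hm hc n,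
      lintegral_add_left .of_discrete, lintegral_add_left .of_discrete,
      lintegral_tsum fun _ => Measurable.of_discrete.aemeasurable]
    simp [lintegral_mul_const _ (Measurable.of_discrete (α := ℕ))]
  rw [key μ, key ν]
  exact add_le_add (add_le_add le_rfl (mul_le_mul_left (h 0) _))
    (ENNReal.tsum_le_tsum fun t => mul_le_mul_left (h (t + 1)) _)

/-! ### Decoupling one coordinate -/

section Decoupling

variable {Ω E : Type*} [MeasurableSpace Ω] [MeasurableSpace E] {P : Measure Ω}
  {X : Ω → ℕ} {Z : Ω → E} {F : ℕ → E → ℝ}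

theorem lintegral_ofReal_joint_eq (hX : Measurable X) (hZ : Measurable Z)
    (hF : ∀ n, Measurable (F n)) (h0 : ∀ n z, 0 ≤ F n z) (hm : ∀ z, Monotone fun n => F n z) :
    ∫⁻ ω, ENNReal.ofReal (F (X ω) (Z ω)) ∂P = ∫⁻ ω, ENNReal.ofReal (F 0 (Z ω)) ∂P +
      ∑' t, ∫⁻ ω in {ω | t + 1 ≤ X ω}, ENNReal.ofReal (F (t + 1) (Z ω) - F t (Z ω)) ∂P := by
  have e : ∀ ω, ENNReal.ofReal (F (X ω) (Z ω)) = ENNReal.ofReal (F 0 (Z ω)) +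
      ∑' t, {ω | t + 1 ≤ X ω}.indicator
        (fun ω => ENNReal.ofReal (F (t + 1) (Z ω) - F t (Z ω))) ω := fun ω => by
    rw [ofReal_eq_add_tsum (fun n => h0 n (Z ω)) (hm (Z ω)) (X ω)]
    rfl
  have hs : ∀ t, MeasurableSet {ω | t + 1 ≤ X ω} := fun t =>
    hX (.of_discrete (s := Set.Ici (t + 1)))
  have hd : ∀ t, Measurable fun ω => ENNReal.ofReal (F (t + 1) (Z ω) - F t (Z ω)) := fun t =>
    (((hF _).comp hZ).sub ((hF _).comp hZ)).ennreal_ofReal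
  rw [lintegral_congr e, lintegral_add_left (f := fun ω => ENNReal.ofReal (F 0 (Z ω)))
      ((hF 0).comp hZ).ennreal_ofReal,
    lintegral_tsum fun t => ((hd t).indicator (hs t)).aemeasurable]
  simp_rw [fun t => lintegral_indicator (hs t) (μ := P)
    (fun ω => ENNReal.ofReal (F (t + 1) (Z ω) - F t (Z ω)))]

/-- The same telescoping as in `lintegral_ofReal_joint_eq`, with `X` independent of `Z`: the
integral over the event `{t + 1 ≤ X}` becomes a product, and the two series can be compared term by
term. -/
theorem lintegral_ofReal_decoupled_eq [IsProbabilityMeasure P] (hX : Measurable X)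
    (hZ : Measurable Z) (hF : ∀ n, Measurable (F n)) (h0 : ∀ n z, 0 ≤ F n z) (hm : ∀ z, Monotone fun n => F n z) :
    ∫⁻ n, ∫⁻ ω, ENNReal.ofReal (F n (Z ω)) ∂P ∂(P.map X) = ∫⁻ ω, ENNReal.ofReal (F 0 (Z ω)) ∂P +
      ∑' t, P {ω | t + 1 ≤ X ω} * ∫⁻ ω, ENNReal.ofReal (F (t + 1) (Z ω) - F t (Z ω)) ∂P := by
  have hd : ∀ t, Measurable fun ω => ENNReal.ofReal (F (t + 1) (Z ω) - F t (Z ω)) := fun t =>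
    (((hF _).comp hZ).sub ((hF _).comp hZ)).ennreal_ofReal
  have e : ∀ n, ∫⁻ ω, ENNReal.ofReal (F n (Z ω)) ∂P = ∫⁻ ω, ENNReal.ofReal (F 0 (Z ω)) ∂P +
      ∑' t, {x : ℕ | t + 1 ≤ x}.indicator
        (fun _ => ∫⁻ ω, ENNReal.ofReal (F (t + 1) (Z ω) - F t (Z ω)) ∂P) n := fun n => by
    rw [lintegral_congr fun ω => ofReal_eq_add_tsum (fun n => h0 n (Z ω)) (hm (Z ω)) n]
    have hi : ∀ t : ℕ, Measurable fun ω => {x : ℕ | t + 1 ≤ x}.indicator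
        (fun _ => ENNReal.ofReal (F (t + 1) (Z ω) - F t (Z ω))) n := fun t => by
      by_cases h : t < n <;> simp [Set.indicator, h, hd t]
    rw [lintegral_add_left (f := fun ω => ENNReal.ofReal (F 0 (Z ω)))
      ((hF 0).comp hZ).ennreal_ofReal,
      lintegral_tsum fun t => (hi t).aemeasurable]
    congr 2
    ext t
    by_cases h : t < n <;> simp [Set.indicator, h]
  have : IsProbabilityMeasure (P.map X) := Measure.isProbabilityMeasure_map hX.aemeasurable
  rw [lintegral_congr e, lintegral_add_left measurable_const,
    lintegral_tsum fun t => Measurable.of_discrete.aemeasurable]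
  congr 1
  · simp
  · congr 1
    ext t
    rw [lintegral_indicator .of_discrete, setLIntegral_const, Measure.map_apply hX .of_discrete,
      mul_comm]
    rfl

end Decoupling

/-- The tuple with `m + 1` independent coordinates is integrated one coordinate at a time. -/
theorem lintegral_pi_cons {m : ℕ} (μ : Fin (m + 1) → Measure ℕ) [∀ i, IsProbabilityMeasure (μ i)]
    (f : (Fin (m + 1) → ℕ) → ℝ≥0∞) :
    ∫⁻ x, f x ∂(Measure.pi μ) =
      ∫⁻ n, ∫⁻ z, f (Fin.cons n z) ∂(Measure.pi fun i => μ i.succ) ∂(μ 0) := by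
  have hmp := (measurePreserving_piFinSuccAbove μ 0).symm
  rw [← hmp.lintegral_comp_emb (MeasurableEquiv.measurableEmbedding _),
    lintegral_prod _ Measurable.of_discrete.aemeasurable]
  simp [MeasurableEquiv.piFinSuccAbove, Fin.insertNthEquiv]

/-! ### Counts as natural numbers -/

section Counts

variable {d : ℕ} {Ω : Type u} [MeasurableSpace Ω] {P : Measure Ω}
  {Φ : Ω → Measure (EuclideanSpace ℝ (Fin d))}

/-- The number of points in `B`, as a natural number. -/
noncomputable def natCount (Φ : Ω → Measure (EuclideanSpace ℝ (Fin d)))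
    (B : Set (EuclideanSpace ℝ (Fin d))) (ω : Ω) : ℕ :=
  ⌊pointCount Φ B ω⌋₊

/-- The vector of the numbers of points in the sets `A j`, as natural numbers. -/
noncomputable def natCountVector (Φ : Ω → Measure (EuclideanSpace ℝ (Fin d)))
    {m : ℕ} (A : Fin m → Set (EuclideanSpace ℝ (Fin d))) (ω : Ω) : Fin m → ℕ :=
  fun j => natCount Φ (A j) ω

variable {m : ℕ} {B : Set (EuclideanSpace ℝ (Fin d))}
  {A : Fin m → Set (EuclideanSpace ℝ (Fin d))}

theorem IsPointProcess.measurable_pointCount (hΦ : IsPointProcess Φ P) (hB : MeasurableSet B) :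
    Measurable (pointCount Φ B) :=
  ((Measure.measurable_coe hB).comp hΦ.measurable).ennreal_toReal

theorem IsPointProcess.measurable_natCount (hΦ : IsPointProcess Φ P) (hB : MeasurableSet B) :
    Measurable (natCount Φ B) :=
  Nat.measurable_floor.comp (hΦ.measurable_pointCount hB)

theorem IsPointProcess.measurable_natCountVector (hΦ : IsPointProcess Φ P)
    (hA : ∀ j, MeasurableSet (A j)) : Measurable (natCountVector Φ A) :=
  measurable_pi_lambda _ fun j => hΦ.measurable_natCount (hA j)

theorem IsPointProcess.ae_eq_natCount (hΦ : IsPointProcess Φ P) :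
    ∀ᵐ ω ∂P, ∀ B : Set (EuclideanSpace ℝ (Fin d)), MeasurableSet B → Bornology.IsBounded B →
      Φ ω B = natCount Φ B ω ∧ pointCount Φ B ω = natCount Φ B ω := by
  filter_upwards [hΦ.counting] with ω hω B hB hb
  obtain ⟨n, hn⟩ := hω B hB hb
  simp [natCount, pointCount, measureReal_def, hn]

theorem IsPointProcess.lintegral_natCount (hΦ : IsPointProcess Φ P) (hB : MeasurableSet B)
    (hb : Bornology.IsBounded B) :
    ∫⁻ ω, (natCount Φ B ω : ℝ≥0∞) ∂P = meanMeasure Φ P B := by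
  rw [meanMeasure_apply hΦ hB]
  refine lintegral_congr_ae ?_
  filter_upwards [hΦ.ae_eq_natCount] with ω hω using (hω B hB hb).1.symm

theorem meanMeasure_lt_top [IsLocallyFiniteMeasure (meanMeasure Φ P)]
    (hb : Bornology.IsBounded B) : meanMeasure Φ P B < ∞ :=
  hb.measure_lt_top

/-! ### Correlation inequalities -/

theorem covariance_indicator_one [IsProbabilityMeasure P] {E F : Set Ω} (hE : MeasurableSet E)
    (hF : MeasurableSet F) :
    covariance (E.indicator (1 : Ω → ℝ)) (F.indicator 1) P =
      P.real (E ∩ F) - P.real E * P.real F := by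
  have hm : ∀ {G : Set Ω}, MeasurableSet G → MemLp (G.indicator (1 : Ω → ℝ)) 2 P :=
    fun hG => (memLp_const 1).indicator hG
  rw [covariance_eq_sub (hm hE) (hm hF), ← Set.inter_indicator_one,
    integral_indicator_one (hE.inter hF), integral_indicator_one hE, integral_indicator_one hF]

theorem measure_inter_le_iff_covariance [IsProbabilityMeasure P] {E F : Set Ω}
    (hE : MeasurableSet E) (hF : MeasurableSet F) :
    P (E ∩ F) ≤ P E * P F ↔ covariance (E.indicator (1 : Ω → ℝ)) (F.indicator 1) P ≤ 0 := by
  rw [covariance_indicator_one hE hF, sub_nonpos, measureReal_def, measureReal_def, measureReal_def,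
    ← ENNReal.toReal_mul, ENNReal.toReal_le_toReal (by finiteness) (by finiteness)]

theorem le_measure_inter_iff_covariance [IsProbabilityMeasure P] {E F : Set Ω}
    (hE : MeasurableSet E) (hF : MeasurableSet F) :
    P E * P F ≤ P (E ∩ F) ↔ 0 ≤ covariance (E.indicator (1 : Ω → ℝ)) (F.indicator 1) P := by
  rw [covariance_indicator_one hE hF, sub_nonneg, measureReal_def, measureReal_def, measureReal_def,
    ← ENNReal.toReal_mul, ENNReal.toReal_le_toReal (by finiteness) (by finiteness)]

/-- Turns an upper set of integer vectors into an admissible test function on `ℝ^k`; `e` selects the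
coordinates that it reads. -/
theorem monotone_indicator_floor {k m : ℕ} {s : Set (Fin m → ℕ)} (hs : IsUpperSet s)
    (e : Fin m → Fin k) :
    Monotone ({x : Fin k → ℝ | (fun j => ⌊x (e j)⌋₊) ∈ s}.indicator (1 : (Fin k → ℝ) → ℝ)) := by
  intro x y hxy
  by_cases hx : x ∈ {x : Fin k → ℝ | (fun j => ⌊x (e j)⌋₊) ∈ s}
  · have hy : y ∈ {x : Fin k → ℝ | (fun j => ⌊x (e j)⌋₊) ∈ s} :=
      hs (fun j => Nat.floor_mono (hxy (e j))) hx
    simp [Set.indicator_of_mem hx, Set.indicator_of_mem hy]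
  · rw [Set.indicator_of_notMem hx]
    exact Set.indicator_nonneg (fun _ _ => zero_le_one) _

theorem indicator_one_mem_Icc {α : Type*} (s : Set α) (x : α) :
    s.indicator (1 : α → ℝ) x ∈ Set.Icc (0 : ℝ) 1 :=
  ⟨Set.indicator_nonneg (fun _ _ => zero_le_one) _,
    Set.indicator_le_self' (fun _ _ => zero_le_one) x⟩

theorem IsNegativelyAssociated.measure_inter_le [IsProbabilityMeasure P]
    (h : IsNegativelyAssociated Φ P) (hΦ : IsPointProcess Φ P) (hB : MeasurableSet B)
    (hb : Bornology.IsBounded B) (hA : ∀ j, MeasurableSet (A j))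
    (hAb : ∀ j, Bornology.IsBounded (A j)) (hd : ∀ j, Disjoint B (A j)) (t : ℕ)
    {s : Set (Fin m → ℕ)} (hs : IsUpperSet s) :
    P ({ω | t ≤ natCount Φ B ω} ∩ {ω | natCountVector Φ A ω ∈ s}) ≤
      P {ω | t ≤ natCount Φ B ω} * P {ω | natCountVector Φ A ω ∈ s} := by
  refine (measure_inter_le_iff_covariance
    (hΦ.measurable_natCount hB (.of_discrete (s := Set.Ici t)))
    (hΦ.measurable_natCountVector hA (.of_discrete (s := s)))).2 ?_
  exact h 1 m (fun _ => B) A (fun _ => hB) (fun _ => hb) hA hAb (by simpa using hd) _ _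
    (monotone_indicator_floor (s := {y : Fin 1 → ℕ | t ≤ y 0})
      (fun x y hxy hx => le_trans (α := ℕ) hx (hxy 0)) id)
    (monotone_indicator_floor hs id) (indicator_one_mem_Icc _) (indicator_one_mem_Icc _)

theorem IsAssociated.le_measure_inter [IsProbabilityMeasure P]
    (h : IsAssociated Φ P) (hΦ : IsPointProcess Φ P) (hB : MeasurableSet B)
    (hb : Bornology.IsBounded B) (hA : ∀ j, MeasurableSet (A j))
    (hAb : ∀ j, Bornology.IsBounded (A j)) (t : ℕ) {s : Set (Fin m → ℕ)} (hs : IsUpperSet s) :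
    P {ω | t ≤ natCount Φ B ω} * P {ω | natCountVector Φ A ω ∈ s} ≤
      P ({ω | t ≤ natCount Φ B ω} ∩ {ω | natCountVector Φ A ω ∈ s}) := by
  refine (le_measure_inter_iff_covariance
    (hΦ.measurable_natCount hB (.of_discrete (s := Set.Ici t)))
    (hΦ.measurable_natCountVector hA (.of_discrete (s := s)))).2 ?_
  -- Association has a single family of sets for both functions: `B` is put in front of `A`, one
  -- function reads coordinate `0` and the other the rest.
  exact h (m + 1) (Fin.cons B A) (Fin.cases hB hA) (Fin.cases hb hAb) _ _
    (monotone_indicator_floor (s := {y : Fin 1 → ℕ | t ≤ y 0})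
      (fun x y hxy hx => le_trans (α := ℕ) hx (hxy 0)) (fun _ => 0))
    (monotone_indicator_floor hs Fin.succ) (indicator_one_mem_Icc _) (indicator_one_mem_Icc _)

/-- Layer-cake formula. The superlevel sets of an increasing `h` are upper sets, so correlation
inequalities for events extend to unbounded increasing functions. -/
theorem setLIntegral_ofReal_eq_lintegral_meas_lt {E : Set Ω} {Z : Ω → Fin m → ℕ}
    (hZ : Measurable Z) {h : (Fin m → ℕ) → ℝ} (h0 : ∀ z, 0 ≤ h z) :
    ∫⁻ ω in E, ENNReal.ofReal (h (Z ω)) ∂P =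
      ∫⁻ s in Set.Ioi (0 : ℝ), P (E ∩ {ω | Z ω ∈ {z | s < h z}}) := by
  rw [lintegral_eq_lintegral_meas_lt _ (.of_forall fun ω => h0 _)
    ((Measurable.of_discrete (f := h)).comp hZ).aemeasurable]
  refine lintegral_congr fun s => ?_
  rw [Set.inter_comm]
  exact Measure.restrict_apply (hZ (.of_discrete (s := {z | s < h z})))

theorem measurable_measure_meas_lt {Z : Ω → Fin m → ℕ} (h : (Fin m → ℕ) → ℝ) :
    Measurable fun s : ℝ => P {ω | Z ω ∈ {z | s < h z}} :=
  Antitone.measurable fun _ _ hst => measure_mono fun _ hω => lt_of_le_of_lt hst hω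

theorem isUpperSet_lt_of_monotone {h : (Fin m → ℕ) → ℝ} (hm : Monotone h) (s : ℝ) :
    IsUpperSet {z | s < h z} :=
  fun _ _ hxy hx => lt_of_lt_of_le hx (hm hxy)

theorem setLIntegral_le_of_measure_inter_le {E : Set Ω} {Z : Ω → Fin m → ℕ} (hZ : Measurable Z)
    (H : ∀ s, IsUpperSet s → P (E ∩ {ω | Z ω ∈ s}) ≤ P E * P {ω | Z ω ∈ s})
    {h : (Fin m → ℕ) → ℝ} (h0 : ∀ z, 0 ≤ h z) (hm : Monotone h) :
    ∫⁻ ω in E, ENNReal.ofReal (h (Z ω)) ∂P ≤ P E * ∫⁻ ω, ENNReal.ofReal (h (Z ω)) ∂P := by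
  rw [← setLIntegral_univ (μ := P), setLIntegral_ofReal_eq_lintegral_meas_lt hZ h0,
    setLIntegral_ofReal_eq_lintegral_meas_lt hZ h0]
  simp only [Set.univ_inter]
  rw [← lintegral_const_mul _ (measurable_measure_meas_lt h)]
  exact lintegral_mono fun s => H _ (isUpperSet_lt_of_monotone hm s)

theorem le_setLIntegral_of_le_measure_inter {E : Set Ω} {Z : Ω → Fin m → ℕ} (hZ : Measurable Z)
    (H : ∀ s, IsUpperSet s → P E * P {ω | Z ω ∈ s} ≤ P (E ∩ {ω | Z ω ∈ s}))
    {h : (Fin m → ℕ) → ℝ} (h0 : ∀ z, 0 ≤ h z) (hm : Monotone h) :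
    P E * ∫⁻ ω, ENNReal.ofReal (h (Z ω)) ∂P ≤ ∫⁻ ω in E, ENNReal.ofReal (h (Z ω)) ∂P := by
  rw [← setLIntegral_univ (μ := P), setLIntegral_ofReal_eq_lintegral_meas_lt hZ h0,
    setLIntegral_ofReal_eq_lintegral_meas_lt hZ h0]
  simp only [Set.univ_inter]
  rw [← lintegral_const_mul _ (measurable_measure_meas_lt h)]
  exact lintegral_mono fun s => H _ (isUpperSet_lt_of_monotone hm s)

/-! ### Poisson marginals -/

theorem lintegral_natCast_poissonMeasure (r : ℝ≥0) :
    ∫⁻ n, (n : ℝ≥0∞) ∂(poissonMeasure r) = r := by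
  have h1 : ∑' n : ℕ, ENNReal.ofReal (Real.exp (-r) * r ^ n / n.factorial) = 1 := by
    rw [← ENNReal.ofReal_tsum_of_nonneg (fun n => by positivity)
      (hasSum_one_poissonMeasure r).summable, (hasSum_one_poissonMeasure r).tsum_eq,
      ENNReal.ofReal_one]
  rw [poissonMeasure, lintegral_sum_measure]
  simp only [lintegral_smul_measure, lintegral_dirac, smul_eq_mul]
  -- The term `n = 0` vanishes, and `(n + 1) r^(n+1) / (n+1)! = r · r^n / n!` reduces the rest to
  -- the total mass `h1`.
  rw [tsum_eq_zero_add' ENNReal.summable, ← mul_one (r : ℝ≥0∞), ← h1, ← ENNReal.tsum_mul_left]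
  simp only [Nat.cast_zero, mul_zero, zero_add]
  refine tsum_congr fun n => ?_
  rw [← ENNReal.ofReal_natCast, ← ENNReal.ofReal_coe_nnreal, ← ENNReal.ofReal_mul (by positivity),
    ← ENNReal.ofReal_mul (by positivity), Nat.factorial_succ]
  congr 1
  push_cast
  field_simp
  ring

theorem convexOn_max_sub_zero (t : ℝ) : ConvexOn ℝ Set.univ fun x : ℝ => max (x - t) 0 :=
  ((convexOn_id convex_univ).sub (concaveOn_const t convex_univ)).sup
    (convexOn_const 0 convex_univ)

theorem ofReal_max_natCast_sub (n t : ℕ) :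
    ENNReal.ofReal (max ((n : ℝ) - t) 0) = ((n - t : ℕ) : ℝ≥0∞) := by
  rcases le_total t n with h | h
  · rw [max_eq_left (by simpa using h), ← Nat.cast_sub h, ENNReal.ofReal_natCast]
  · rw [max_eq_right (by simpa using h), Nat.sub_eq_zero_of_le h]
    simp

theorem integrable_max_sub_zero {Ω : Type*} [MeasurableSpace Ω] {P : Measure Ω} {X : Ω → ℕ}
    (hX : Measurable X) (hfin : ∫⁻ ω, (X ω : ℝ≥0∞) ∂P < ∞) (t : ℕ) :
    Integrable (fun ω => max ((X ω : ℝ) - t) 0) P := by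
  refine ⟨((Measurable.of_discrete (f := fun n : ℕ => max ((n : ℝ) - t) 0)).comp
    hX).aestronglyMeasurable, ?_⟩
  rw [hasFiniteIntegral_iff_ofReal (.of_forall fun ω => le_max_right ((X ω : ℝ) - t) 0)]
  refine lt_of_le_of_lt (lintegral_mono fun ω => ?_) hfin
  rw [ofReal_max_natCast_sub]
  exact Nat.cast_le.2 (Nat.sub_le _ _)

theorem lintegral_natCast_sub_le_of_cxLE {Ω Ω' : Type*} [MeasurableSpace Ω] [MeasurableSpace Ω']
    {P : Measure Ω} {P' : Measure Ω'} {X : Ω → ℕ} {Y : Ω' → ℕ} (hX : Measurable X)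
    (hY : Measurable Y) (hXfin : ∫⁻ ω, (X ω : ℝ≥0∞) ∂P < ∞)
    (hYfin : ∫⁻ ω, (Y ω : ℝ≥0∞) ∂P' < ∞)
    (h : CxLE (fun ω => (X ω : ℝ)) P (fun ω => (Y ω : ℝ)) P') (t : ℕ) :
    ∫⁻ ω, ((X ω - t : ℕ) : ℝ≥0∞) ∂P ≤ ∫⁻ ω, ((Y ω - t : ℕ) : ℝ≥0∞) ∂P' := by
  have := h _ (convexOn_max_sub_zero t) (integrable_max_sub_zero hX hXfin t)
    (integrable_max_sub_zero hY hYfin t)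
  have := ENNReal.ofReal_le_ofReal this
  rw [ofReal_integral_eq_lintegral_ofReal (integrable_max_sub_zero hX hXfin t)
      (.of_forall fun _ => le_max_right _ _),
    ofReal_integral_eq_lintegral_ofReal (integrable_max_sub_zero hY hYfin t)
      (.of_forall fun _ => le_max_right _ _)] at this
  simpa only [ofReal_max_natCast_sub] using this

theorem CxLE.congr {Ω Ω' : Type*} [MeasurableSpace Ω] [MeasurableSpace Ω']
    {P : Measure Ω} {P' : Measure Ω'} {X X' : Ω → ℝ} {Y Y' : Ω' → ℝ}
    (h : CxLE X P Y P') (hX : X =ᵐ[P] X') (hY : Y =ᵐ[P'] Y') : CxLE X' P Y' P' := by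
  intro φ hφ h1 h2
  have e1 := hX.fun_comp φ
  have e2 := hY.fun_comp φ
  have := h φ hφ (h1.congr e1.symm) (h2.congr e2.symm)
  exact (integral_congr_ae e1).symm.trans_le (this.trans_eq (integral_congr_ae e2))

theorem lintegral_natCast_poissonMeasure_lt_top (r : ℝ≥0) :
    ∫⁻ n, (n : ℝ≥0∞) ∂(poissonMeasure r) < ∞ := by
  rw [lintegral_natCast_poissonMeasure]
  exact ENNReal.coe_lt_top

theorem IsPointProcess.pointCount_ae_eq (hΦ : IsPointProcess Φ P) (hB : MeasurableSet B)
    (hb : Bornology.IsBounded B) : pointCount Φ B =ᵐ[P] fun ω => (natCount Φ B ω : ℝ) := by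
  filter_upwards [hΦ.ae_eq_natCount] with ω hω using (hω B hB hb).2

theorem HasConvexlySubPoissonMarginals.lintegral_sub_le [IsLocallyFiniteMeasure (meanMeasure Φ P)]
    (h : HasConvexlySubPoissonMarginals Φ P) (hΦ : IsPointProcess Φ P) (hB : MeasurableSet B)
    (hb : Bornology.IsBounded B) (t : ℕ) :
    ∫⁻ n, ((n - t : ℕ) : ℝ≥0∞) ∂(P.map (natCount Φ B)) ≤
      ∫⁻ n, ((n - t : ℕ) : ℝ≥0∞) ∂(poissonMeasure (meanMeasure Φ P B).toNNReal) := by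
  rw [lintegral_map .of_discrete (hΦ.measurable_natCount hB)]
  exact lintegral_natCast_sub_le_of_cxLE (hΦ.measurable_natCount hB) measurable_id
    (by rw [hΦ.lintegral_natCount hB hb]; exact meanMeasure_lt_top hb)
    (lintegral_natCast_poissonMeasure_lt_top _)
    ((h B hB hb).congr (hΦ.pointCount_ae_eq hB hb) .rfl) t

theorem HasConvexlySuperPoissonMarginals.lintegral_sub_le
    [IsLocallyFiniteMeasure (meanMeasure Φ P)]
    (h : HasConvexlySuperPoissonMarginals Φ P) (hΦ : IsPointProcess Φ P) (hB : MeasurableSet B)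
    (hb : Bornology.IsBounded B) (t : ℕ) :
    ∫⁻ n, ((n - t : ℕ) : ℝ≥0∞) ∂(poissonMeasure (meanMeasure Φ P B).toNNReal) ≤
      ∫⁻ n, ((n - t : ℕ) : ℝ≥0∞) ∂(P.map (natCount Φ B)) := by
  rw [lintegral_map .of_discrete (hΦ.measurable_natCount hB)]
  exact lintegral_natCast_sub_le_of_cxLE measurable_id (hΦ.measurable_natCount hB)
    (lintegral_natCast_poissonMeasure_lt_top _)
    (by rw [hΦ.lintegral_natCount hB hb]; exact meanMeasure_lt_top hb)
    ((h B hB hb).congr .rfl (hΦ.pointCount_ae_eq hB hb)) t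

end Counts

section Comparison

variable {d : ℕ} {Ω : Type u} [MeasurableSpace Ω] {P : Measure Ω}
  {Φ : Ω → Measure (EuclideanSpace ℝ (Fin d))}

/-! ### Comparison on disjoint sets -/

theorem natCountVector_succ {d : ℕ} {Ω : Type*} (Φ : Ω → Measure (EuclideanSpace ℝ (Fin d)))
    {m : ℕ} (A : Fin (m + 1) → Set (EuclideanSpace ℝ (Fin d))) (ω : Ω) :
    natCountVector Φ A ω =
      Fin.cons (natCount Φ (A 0) ω) (natCountVector Φ (fun j => A j.succ) ω) := by
  ext i
  refine Fin.cases ?_ (fun j => ?_) i <;> simp [natCountVector]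

theorem lintegral_lintegral_cons_swap {m : ℕ} {Z : Ω → Fin m → ℕ} (hZ : Measurable Z)
    [SFinite P] (μ : Measure ℕ) [SFinite μ] (g : (Fin (m + 1) → ℕ) → ℝ) :
    ∫⁻ n, ∫⁻ ω, ENNReal.ofReal (g (Fin.cons n (Z ω))) ∂P ∂μ =
      ∫⁻ ω, ∫⁻ n, ENNReal.ofReal (g (Fin.cons n (Z ω))) ∂μ ∂P :=
  lintegral_lintegral_swap (f := fun n ω => ENNReal.ofReal (g (Fin.cons n (Z ω))))
    ((Measurable.of_discrete (f := fun p : ℕ × (Fin m → ℕ) =>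
      ENNReal.ofReal (g (Fin.cons p.1 p.2)))).comp
        (measurable_fst.prodMk (hZ.comp measurable_snd))).aemeasurable

/-- The law of the counts of a Poisson process in the disjoint sets `A j`. -/
noncomputable def poissonCountLaw (Λ : Measure (EuclideanSpace ℝ (Fin d))) {m : ℕ}
    (A : Fin m → Set (EuclideanSpace ℝ (Fin d))) : Measure (Fin m → ℕ) :=
  Measure.pi fun j => poissonMeasure (Λ (A j)).toNNReal

theorem lintegral_natCountVector_le_poisson [IsProbabilityMeasure P]
    [IsLocallyFiniteMeasure (meanMeasure Φ P)] (hΦ : IsPointProcess Φ P)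
    (hassoc : IsNegativelyAssociated Φ P) (hcx : HasConvexlySubPoissonMarginals Φ P) :
    ∀ {m : ℕ} {A : Fin m → Set (EuclideanSpace ℝ (Fin d))}, (∀ j, MeasurableSet (A j)) →
      (∀ j, Bornology.IsBounded (A j)) → Pairwise (fun i j => Disjoint (A i) (A j)) →
      ∀ {g : (Fin m → ℕ) → ℝ}, IncreasingDcx g →
      ∫⁻ ω, ENNReal.ofReal (g (natCountVector Φ A ω)) ∂P ≤
        ∫⁻ x, ENNReal.ofReal (g x) ∂(poissonCountLaw (meanMeasure Φ P) A) := by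
  intro m
  induction m with
  | zero =>
    intro A _ _ _ g _
    have hg (x : Fin 0 → ℕ) : g x = g 0 := congrArg g (Subsingleton.elim _ _)
    simp [poissonCountLaw, lintegral_congr fun x => congrArg ENNReal.ofReal (hg x),
      fun ω => hg (natCountVector Φ A ω)]
  | succ m ih =>
    intro A hA hb hd g hg
    have hX := hΦ.measurable_natCount (hA 0)
    have hZ := hΦ.measurable_natCountVector fun j => hA (Fin.succ j)
    have : IsProbabilityMeasure (P.map (natCount Φ (A 0))) :=
      Measure.isProbabilityMeasure_map hX.aemeasurable
    have hF0 : ∀ n (z : Fin m → ℕ), 0 ≤ g (Fin.cons n z) := fun _ _ => hg.nonneg _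
    have hFm : ∀ z : Fin m → ℕ, Monotone fun n => g (Fin.cons n z) :=
      fun z s t hst => hg.mono (cons_mono hst le_rfl)
    simp_rw [natCountVector_succ]
    rw [poissonCountLaw, lintegral_pi_cons]
    calc ∫⁻ ω, ENNReal.ofReal (g (Fin.cons (natCount Φ (A 0) ω)
          (natCountVector Φ (fun j => A j.succ) ω))) ∂P
        ≤ ∫⁻ n, ∫⁻ ω, ENNReal.ofReal (g (Fin.cons n
          (natCountVector Φ (fun j => A j.succ) ω))) ∂P ∂(P.map (natCount Φ (A 0))) := by
          rw [lintegral_ofReal_joint_eq (F := fun n z => g (Fin.cons n z)) hX hZ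
              (fun _ => .of_discrete) hF0 hFm,
            lintegral_ofReal_decoupled_eq (F := fun n z => g (Fin.cons n z)) hX hZ
              (fun _ => .of_discrete) hF0 hFm]
          -- The two series differ only in the factor coming from `{t + 1 ≤ X}`.
          gcongr with t
          exact setLIntegral_le_of_measure_inter_le
            (h := fun z => g (Fin.cons (t + 1) z) - g (Fin.cons t z)) hZ
            (fun s hs => hassoc.measure_inter_le hΦ (hA 0) (hb 0) (fun j => hA j.succ)
              (fun j => hb j.succ) (fun j => hd (Fin.succ_ne_zero j).symm) _ hs)
            (fun z => sub_nonneg.2 (hFm z t.le_succ)) fun y z hyz => hg.mono_cons_sub le_rfl hyz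
      _ = ∫⁻ ω, ∫⁻ n, ENNReal.ofReal (g (Fin.cons n
          (natCountVector Φ (fun j => A j.succ) ω))) ∂(P.map (natCount Φ (A 0))) ∂P :=
          lintegral_lintegral_cons_swap hZ _ g
      _ ≤ ∫⁻ ω, ∫⁻ n, ENNReal.ofReal (g (Fin.cons n (natCountVector Φ (fun j => A j.succ) ω)))
          ∂(poissonMeasure (meanMeasure Φ P (A 0)).toNNReal) ∂P :=
          lintegral_mono fun ω => lintegral_ofReal_mono_of_convex
            (hcx.lintegral_sub_le hΦ (hA 0) (hb 0)) (fun n => hF0 n _) (hFm _)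
            fun s t hst => hg.mono_cons_sub hst le_rfl
      _ = ∫⁻ n, ∫⁻ ω, ENNReal.ofReal (g (Fin.cons n (natCountVector Φ (fun j => A j.succ) ω))) ∂P
          ∂(poissonMeasure (meanMeasure Φ P (A 0)).toNNReal) :=
          (lintegral_lintegral_cons_swap hZ _ g).symm
      _ ≤ _ := lintegral_mono fun n => ih (fun j => hA j.succ) (fun j => hb j.succ)
          (fun i j hij => hd ((Fin.succ_injective m).ne hij)) (hg.cons n)

/-- The chain of the sub-Poisson case read backwards. Association correlates counts of overlapping
sets too, so disjointness of the cells plays no role here. -/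
theorem poisson_le_lintegral_natCountVector [IsProbabilityMeasure P]
    [IsLocallyFiniteMeasure (meanMeasure Φ P)] (hΦ : IsPointProcess Φ P)
    (hassoc : IsAssociated Φ P) (hcx : HasConvexlySuperPoissonMarginals Φ P) :
    ∀ {m : ℕ} {A : Fin m → Set (EuclideanSpace ℝ (Fin d))}, (∀ j, MeasurableSet (A j)) →
      (∀ j, Bornology.IsBounded (A j)) →
      ∀ {g : (Fin m → ℕ) → ℝ}, IncreasingDcx g →
      ∫⁻ x, ENNReal.ofReal (g x) ∂(poissonCountLaw (meanMeasure Φ P) A) ≤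
        ∫⁻ ω, ENNReal.ofReal (g (natCountVector Φ A ω)) ∂P := by
  intro m
  induction m with
  | zero =>
    intro A _ _ g _
    have hg (x : Fin 0 → ℕ) : g x = g 0 := congrArg g (Subsingleton.elim _ _)
    simp [poissonCountLaw, lintegral_congr fun x => congrArg ENNReal.ofReal (hg x),
      fun ω => hg (natCountVector Φ A ω)]
  | succ m ih =>
    intro A hA hb g hg
    have hX := hΦ.measurable_natCount (hA 0)
    have hZ := hΦ.measurable_natCountVector fun j => hA (Fin.succ j)
    have : IsProbabilityMeasure (P.map (natCount Φ (A 0))) :=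
      Measure.isProbabilityMeasure_map hX.aemeasurable
    have hF0 : ∀ n (z : Fin m → ℕ), 0 ≤ g (Fin.cons n z) := fun _ _ => hg.nonneg _
    have hFm : ∀ z : Fin m → ℕ, Monotone fun n => g (Fin.cons n z) :=
      fun z s t hst => hg.mono (cons_mono hst le_rfl)
    simp_rw [natCountVector_succ]
    rw [poissonCountLaw, lintegral_pi_cons]
    calc _ ≤ ∫⁻ n, ∫⁻ ω, ENNReal.ofReal (g (Fin.cons n
          (natCountVector Φ (fun j => A j.succ) ω))) ∂P
          ∂(poissonMeasure (meanMeasure Φ P (A 0)).toNNReal) :=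
          lintegral_mono fun n => ih (fun j => hA j.succ) (fun j => hb j.succ) (hg.cons n)
      _ = ∫⁻ ω, ∫⁻ n, ENNReal.ofReal (g (Fin.cons n (natCountVector Φ (fun j => A j.succ) ω)))
          ∂(poissonMeasure (meanMeasure Φ P (A 0)).toNNReal) ∂P :=
          lintegral_lintegral_cons_swap hZ _ g
      _ ≤ ∫⁻ ω, ∫⁻ n, ENNReal.ofReal (g (Fin.cons n
          (natCountVector Φ (fun j => A j.succ) ω))) ∂(P.map (natCount Φ (A 0))) ∂P :=
          lintegral_mono fun ω => lintegral_ofReal_mono_of_convex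
            (hcx.lintegral_sub_le hΦ (hA 0) (hb 0)) (fun n => hF0 n _) (hFm _)
            fun s t hst => hg.mono_cons_sub hst le_rfl
      _ = ∫⁻ n, ∫⁻ ω, ENNReal.ofReal (g (Fin.cons n
          (natCountVector Φ (fun j => A j.succ) ω))) ∂P ∂(P.map (natCount Φ (A 0))) :=
          (lintegral_lintegral_cons_swap hZ _ g).symm
      _ ≤ _ := by
          rw [lintegral_ofReal_joint_eq (F := fun n z => g (Fin.cons n z)) hX hZ
              (fun _ => .of_discrete) hF0 hFm,
            lintegral_ofReal_decoupled_eq (F := fun n z => g (Fin.cons n z)) hX hZ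
              (fun _ => .of_discrete) hF0 hFm]
          gcongr with t
          exact le_setLIntegral_of_le_measure_inter
            (h := fun z => g (Fin.cons (t + 1) z) - g (Fin.cons t z)) hZ
            (fun s hs => hassoc.le_measure_inter hΦ (hA 0) (hb 0) (fun j => hA j.succ)
              (fun j => hb j.succ) _ hs)
            (fun z => sub_nonneg.2 (hFm z t.le_succ)) fun y z hyz => hg.mono_cons_sub le_rfl hyz

/-! ### Laws and means of Poisson counts -/

theorem IsPoissonPointProcess.map_natCount {Λ : Measure (EuclideanSpace ℝ (Fin d))}
    (hΦ : IsPoissonPointProcess Φ P Λ) {B : Set (EuclideanSpace ℝ (Fin d))}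
    (hB : MeasurableSet B) (hb : Bornology.IsBounded B) :
    P.map (natCount Φ B) = poissonMeasure (Λ B).toNNReal := by
  have := congrArg (Measure.map (Nat.floor : ℝ → ℕ)) (hΦ.law B hB hb)
  rw [Measure.map_map Nat.measurable_floor (hΦ.isPointProcess.measurable_pointCount hB),
    Measure.map_map Nat.measurable_floor .of_discrete] at this
  refine this.trans ?_
  convert Measure.map_id
  ext n
  simp

theorem IsPoissonPointProcess.map_natCountVector [IsProbabilityMeasure P]
    {Λ : Measure (EuclideanSpace ℝ (Fin d))} (hΦ : IsPoissonPointProcess Φ P Λ) {m : ℕ}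
    {A : Fin m → Set (EuclideanSpace ℝ (Fin d))} (hA : ∀ j, MeasurableSet (A j))
    (hb : ∀ j, Bornology.IsBounded (A j)) (hd : Pairwise fun i j => Disjoint (A i) (A j)) :
    P.map (natCountVector Φ A) = poissonCountLaw Λ A := by
  have hi : iIndepFun (fun j => natCount Φ (A j)) P :=
    (hΦ.indep m A hA hb hd).comp (fun _ => Nat.floor) fun _ => Nat.measurable_floor
  have := hi.map_fun_eq_pi_map fun j => (hΦ.isPointProcess.measurable_natCount (hA j)).aemeasurable
  simp_rw [fun j => hΦ.map_natCount (hA j) (hb j)] at this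
  exact this

theorem IsPoissonPointProcess.lintegral_natCount {Λ : Measure (EuclideanSpace ℝ (Fin d))}
    (hΦ : IsPoissonPointProcess Φ P Λ) {B : Set (EuclideanSpace ℝ (Fin d))}
    (hB : MeasurableSet B) (hb : Bornology.IsBounded B) :
    ∫⁻ ω, (natCount Φ B ω : ℝ≥0∞) ∂P = Λ B := by
  have := hΦ.locallyFinite
  rw [← lintegral_map (f := fun n : ℕ => (n : ℝ≥0∞)) .of_discrete
    (hΦ.isPointProcess.measurable_natCount hB), hΦ.map_natCount hB hb,
    lintegral_natCast_poissonMeasure, ENNReal.coe_toNNReal hb.measure_lt_top.ne]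

/-! ### Reduction to disjoint sets -/

theorem exists_disjoint_refinement {k : ℕ} {B : Fin k → Set (EuclideanSpace ℝ (Fin d))}
    (hB : ∀ i, MeasurableSet (B i)) (hb : ∀ i, Bornology.IsBounded (B i)) :
    ∃ (m : ℕ) (A : Fin m → Set (EuclideanSpace ℝ (Fin d))) (S : Fin k → Finset (Fin m)),
      (∀ j, MeasurableSet (A j)) ∧ (∀ j, Bornology.IsBounded (A j)) ∧
      Pairwise (fun i j => Disjoint (A i) (A j)) ∧ ∀ i, B i = ⋃ j ∈ S i, A j := by
  classical
  let e := Fintype.equivFin (Finset (Fin k))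
  let C : Finset (Fin k) → Set (EuclideanSpace ℝ (Fin d)) :=
    -- The cell of `s` collects the points lying in `B i` exactly for `i ∈ s`. Membership in some `B
    -- i` excludes the unbounded complement of the union.
    fun s => {x | (∃ i, x ∈ B i) ∧ ∀ i, x ∈ B i ↔ i ∈ s}
  refine ⟨_, fun j => C (e.symm j), fun i => Finset.univ.filter fun j => i ∈ e.symm j,
    fun j => ?_, fun j => ?_, fun i j hij => ?_, fun i => ?_⟩
  · exact (Measurable.exists fun i => (hB i).mem).setOf.inter
      (Measurable.forall fun i => (hB i).mem.iff measurable_const).setOf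
  · refine (Bornology.isBounded_iUnion.2 hb).subset fun x hx => ?_
    simpa using hx.1
  · refine Set.disjoint_left.2 fun x hx hy => hij (e.symm.injective ?_)
    ext i
    rw [← hx.2 i, hy.2 i]
  · ext x
    simp only [Finset.mem_filter, Finset.mem_univ, true_and, Set.mem_iUnion, exists_prop]
    constructor
    · intro hx
      exact ⟨e (Finset.univ.filter fun i => x ∈ B i), by simp [hx], ⟨i, hx⟩, by simp⟩
    · rintro ⟨j, hj, hx⟩
      exact (hx.2 i).2 hj

/-- The counts of unions of cells, in terms of the counts of the cells. -/
def cellSum {k m : ℕ} (S : Fin k → Finset (Fin m)) (x : Fin m → ℕ) : Fin k → ℝ :=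
  fun i => ∑ j ∈ S i, (x j : ℝ)

theorem cellSum_add {k m : ℕ} (S : Fin k → Finset (Fin m)) (x y : Fin m → ℕ) :
    cellSum S (x + y) = cellSum S x + cellSum S y := by
  ext i
  simp [cellSum, Finset.sum_add_distrib]

theorem cellSum_nonneg {k m : ℕ} (S : Fin k → Finset (Fin m)) (x : Fin m → ℕ) :
    0 ≤ cellSum S x :=
  fun _ => Finset.sum_nonneg fun _ _ => Nat.cast_nonneg _

theorem cellSum_mono {k m : ℕ} (S : Fin k → Finset (Fin m)) : Monotone (cellSum S) :=
  fun _ _ h _ => Finset.sum_le_sum fun j _ => Nat.cast_le.2 (h j)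

/-- A unit step in one cell moves the vector of sums by a fixed nonnegative vector, generally in
several coordinates at once; hence the need for `DirectionallyConvex.monotone_sub` with a general
`v`. -/
theorem DirectionallyConvex.monotone_cellSum_sub {k m : ℕ} {f : (Fin k → ℝ) → ℝ}
    (hf : DirectionallyConvex f) (S : Fin k → Finset (Fin m)) (i : Fin m) :
    Monotone fun x => f (cellSum S (x + Pi.single i 1)) - f (cellSum S x) := by
  simp only [cellSum_add]
  exact (hf.monotone_sub (cellSum_nonneg S _)).comp (cellSum_mono S)

theorem IsPointProcess.countVector_ae_eq (hΦ : IsPointProcess Φ P) {k m : ℕ}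
    {B : Fin k → Set (EuclideanSpace ℝ (Fin d))} {A : Fin m → Set (EuclideanSpace ℝ (Fin d))}
    {S : Fin k → Finset (Fin m)} (hA : ∀ j, MeasurableSet (A j))
    (hb : ∀ j, Bornology.IsBounded (A j)) (hd : Pairwise fun i j => Disjoint (A i) (A j))
    (hBA : ∀ i, B i = ⋃ j ∈ S i, A j) :
    countVector Φ B =ᵐ[P] fun ω => cellSum S (natCountVector Φ A ω) := by
  filter_upwards [hΦ.ae_eq_natCount] with ω hω
  ext i
  simp only [countVector, pointCount, cellSum, natCountVector]
  rw [hBA i, measureReal_biUnion_finset (fun i _ j _ hij => hd hij) (fun j _ => hA j)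
    fun j _ => by rw [(hω (A j) (hA j) (hb j)).1]; exact ENNReal.natCast_ne_top _]
  exact Finset.sum_congr rfl fun j _ => (hω (A j) (hA j) (hb j)).2

/-- The expectation of `h` in terms of that of `h` minus its linear part at the origin. -/
theorem lintegral_sub_linear_and_integral_eq {m : ℕ} {Z : Ω → Fin m → ℕ} [IsProbabilityMeasure P]
    (hZ : Measurable Z) (hfin : ∀ j, ∫⁻ ω, (Z ω j : ℝ≥0∞) ∂P < ∞) {h : (Fin m → ℕ) → ℝ}
    (hh : ∀ i, Monotone fun x => h (x + Pi.single i 1) - h x)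
    (hint : Integrable (fun ω => h (Z ω)) P) :
    ∫⁻ ω, ENNReal.ofReal (h (Z ω) - h 0 - ∑ i, (Z ω i : ℝ) * (h (Pi.single i 1) - h 0)) ∂P < ∞ ∧
    ∫ ω, h (Z ω) ∂P =
      (∫⁻ ω, ENNReal.ofReal
        (h (Z ω) - h 0 - ∑ i, (Z ω i : ℝ) * (h (Pi.single i 1) - h 0)) ∂P).toReal +
      (h 0 + ∑ i, (∫⁻ ω, (Z ω i : ℝ≥0∞) ∂P).toReal * (h (Pi.single i 1) - h 0)) := by
  have hmeas : ∀ i, Measurable fun ω => (Z ω i : ℝ≥0∞) := fun i =>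
    (Measurable.of_discrete (f := fun x : Fin m → ℕ => (x i : ℝ≥0∞))).comp hZ
  have hi : ∀ i, Integrable (fun ω => (Z ω i : ℝ)) P := fun i => by
    simpa using integrable_toReal_of_lintegral_ne_top (hmeas i).aemeasurable (hfin i).ne
  have hm : ∀ i, ∫ ω, (Z ω i : ℝ) ∂P = (∫⁻ ω, (Z ω i : ℝ≥0∞) ∂P).toReal := fun i => by
    simpa using integral_toReal (hmeas i).aemeasurable
      (.of_forall fun ω => ENNReal.natCast_lt_top (Z ω i))
  have hlin : Integrable (fun ω => ∑ i, (Z ω i : ℝ) * (h (Pi.single i 1) - h 0)) P :=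
    integrable_finsetSum _ fun i _ => (hi i).mul_const _
  have h1 : Integrable (fun ω => h (Z ω) - h 0) P := hint.sub (integrable_const _)
  have h2 := h1.sub hlin
  have hnn : ∀ ω, 0 ≤ h (Z ω) - h 0 - ∑ i, (Z ω i : ℝ) * (h (Pi.single i 1) - h 0) :=
    fun ω => (increasingDcx_sub_linear hh).nonneg (Z ω)
  have hlin_eq : ∫ ω, ∑ i, (Z ω i : ℝ) * (h (Pi.single i 1) - h 0) ∂P =
      ∑ i, (∫⁻ ω, (Z ω i : ℝ≥0∞) ∂P).toReal * (h (Pi.single i 1) - h 0) := by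
    rw [integral_finsetSum _ fun i _ => (hi i).mul_const _]
    simp_rw [integral_mul_const, hm]
  refine ⟨(hasFiniteIntegral_iff_ofReal (.of_forall hnn)).1 h2.2, ?_⟩
  rw [← integral_eq_lintegral_of_nonneg_ae (.of_forall hnn) h2.1, integral_sub h1 hlin,
    integral_sub hint (integrable_const _), hlin_eq]
  simp

theorem pointProcessDcxLE_of_disjoint {Ω' : Type v} [MeasurableSpace Ω'] {P' : Measure Ω'}
    {Ψ : Ω' → Measure (EuclideanSpace ℝ (Fin d))} [IsProbabilityMeasure P]
    [IsProbabilityMeasure P'] {Λ : Measure (EuclideanSpace ℝ (Fin d))} [IsLocallyFiniteMeasure Λ]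
    (hΦ : IsPointProcess Φ P) (hΨ : IsPointProcess Ψ P')
    (hΦm : ∀ B, MeasurableSet B → Bornology.IsBounded B →
      ∫⁻ ω, (natCount Φ B ω : ℝ≥0∞) ∂P = Λ B)
    (hΨm : ∀ B, MeasurableSet B → Bornology.IsBounded B →
      ∫⁻ ω, (natCount Ψ B ω : ℝ≥0∞) ∂P' = Λ B)
    (H : ∀ (m : ℕ) (A : Fin m → Set (EuclideanSpace ℝ (Fin d))), (∀ j, MeasurableSet (A j)) →
      (∀ j, Bornology.IsBounded (A j)) → Pairwise (fun i j => Disjoint (A i) (A j)) →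
      ∀ g : (Fin m → ℕ) → ℝ, IncreasingDcx g →
      ∫⁻ ω, ENNReal.ofReal (g (natCountVector Φ A ω)) ∂P ≤
        ∫⁻ ω, ENNReal.ofReal (g (natCountVector Ψ A ω)) ∂P') :
    PointProcessDcxLE Φ P Ψ P' := by
  intro k B hB hBb f hf hfΦ hfΨ
  obtain ⟨m, A, S, hA, hb, hd, hBA⟩ := exists_disjoint_refinement hB hBb
  have eΦ := (hΦ.countVector_ae_eq hA hb hd hBA).fun_comp f
  have eΨ := (hΨ.countVector_ae_eq hA hb hd hBA).fun_comp f
  have hh := hf.monotone_cellSum_sub S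
  have hmΦ : ∀ j, ∫⁻ ω, (natCountVector Φ A ω j : ℝ≥0∞) ∂P = Λ (A j) :=
    fun j => hΦm _ (hA j) (hb j)
  have hmΨ : ∀ j, ∫⁻ ω, (natCountVector Ψ A ω j : ℝ≥0∞) ∂P' = Λ (A j) :=
    fun j => hΨm _ (hA j) (hb j)
  have hfin : ∀ j, Λ (A j) < ∞ := fun j => (hb j).measure_lt_top
  obtain ⟨-, iΦ⟩ := lintegral_sub_linear_and_integral_eq (h := fun x => f (cellSum S x))
    (hΦ.measurable_natCountVector hA)
    (fun j => (hmΦ j).trans_lt (hfin j)) hh (hfΦ.congr eΦ)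
  obtain ⟨fΨ, iΨ⟩ := lintegral_sub_linear_and_integral_eq (h := fun x => f (cellSum S x))
    (hΨ.measurable_natCountVector hA)
    (fun j => (hmΨ j).trans_lt (hfin j)) hh (hfΨ.congr eΨ)
  refine (integral_congr_ae eΦ).trans_le (le_trans ?_ (integral_congr_ae eΨ).ge)
  refine iΦ.trans_le (le_trans ?_ iΨ.ge)
  -- Equal means make the affine parts identical. Finiteness is needed only on the larger side, to
  -- pass from `[0, ∞]` to real numbers.
  simp only [hmΦ, hmΨ]
  exact add_le_add_left (ENNReal.toReal_mono fΨ.ne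
    (H m A hA hb hd _ (increasingDcx_sub_linear (h := fun x => f (cellSum S x)) hh))) _

end Comparison

/-! ### The sub-Poisson and super-Poisson comparisons -/

theorem mainTheorem2 {d : ℕ} {Ω : Type u} [MeasurableSpace Ω] (P : Measure Ω)
    [IsProbabilityMeasure P] (Φ : Ω → Measure (EuclideanSpace ℝ (Fin d)))
    (hΦ : IsPointProcess Φ P) (hmean : IsLocallyFiniteMeasure (meanMeasure Φ P)) :
    (IsNegativelyAssociated Φ P → HasConvexlySubPoissonMarginals Φ P →
      IsDcxSubPoisson.{u, v} Φ P) ∧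
    (IsAssociated Φ P → HasConvexlySuperPoissonMarginals Φ P →
      IsDcxSuperPoisson.{u, v} Φ P) := by
  refine ⟨fun hassoc hcx Ω' _ P' _ Ψ hΨ => ?_, fun hassoc hcx Ω' _ P' _ Ψ hΨ => ?_⟩
  · refine pointProcessDcxLE_of_disjoint hΦ hΨ.isPointProcess
      (fun B => hΦ.lintegral_natCount) (fun B => hΨ.lintegral_natCount)
      fun m A hA hb hd g hg => ?_
    rw [← lintegral_map (f := fun x => ENNReal.ofReal (g x)) .of_discrete
      (hΨ.isPointProcess.measurable_natCountVector hA), hΨ.map_natCountVector hA hb hd]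
    exact lintegral_natCountVector_le_poisson hΦ hassoc hcx hA hb hd hg
  · refine pointProcessDcxLE_of_disjoint hΨ.isPointProcess hΦ
      (fun B => hΨ.lintegral_natCount) (fun B => hΦ.lintegral_natCount)
      fun m A hA hb hd g hg => ?_
    rw [← lintegral_map (f := fun x => ENNReal.ofReal (g x)) .of_discrete
      (hΨ.isPointProcess.measurable_natCountVector hA), hΨ.map_natCountVector hA hb hd]
    exact poisson_le_lintegral_natCountVector hΦ hassoc hcx hA hb hg
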